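/- Let $\Sigma$ be an alphabet and $\Xi=\{x_1,\dots,x_n\}$ a set of $n$ unknowns. A word equation $E: u=v$ on $n$ unknowns is a pair of words $u,v\in\Xi^*$; it is nontrivial if $u$ and $v$ are different words, and $|E|_x$ denotes the number of occurrences of the unknown $x$ in the word $uv$. A solution of $E$ is a monoid morphism $h:\Xi^*\to\Sigma^*$ with $h(u)=h(v)$. The rank of $h$ is the smallest $r$ for which there is a set $A\subseteq\Sigma^*$ of $r$ words with $h(x)\in A^*$ for every $x\in\Xi$, and the length type of $h$ is the vector $(|h(x_1)|,\dots,|h(x_n)|)\in\mathbb{N}_0^n\subset\mathbb{Q}^n$. Let $\mathrm{Sol}_r(E)$ be the set of solutions of $E$ of rank $r$, and $\mathrm{Sol}_r^L(E)$ the set of those that have length type $L\in\mathbb{N}_0^n$. Theorem. Let $E_1,E_2$ be nontrivial word equations on $n$ unknowns with $\mathrm{Sol}_{n-1}(E_1)\neq\mathrm{Sol}_{n-1}(E_2)$, and let $S\subset\mathbb{Q}^n$ be the set of length types of the morphisms in $\mathrm{Sol}_{n-1}(E_1)\cap\mathrm{Sol}_{n-1}(E_2)$. (a) There are two distinct unknowns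 $x_k,x_l$ such that $S$ is covered by a union of $(|E_1|_{x_k}+|E_1|_{x_l})^2$ (not necessarily distinct) $(n-1)$-dimensional subspaces of $\mathbb{Q}^n$. (b) If $V_1,\dots,V_m$ is any finite family of $(n-1)$-dimensional subspaces of $\mathbb{Q}^n$ that covers $S$ and is minimal, in the sense that no proper subfamily covers $S$, and if $L\in\mathbb{N}_0^n$ lies in $V_i$ for some $i$, then $\mathrm{Sol}_{n-1}^L(E_1)=\mathrm{Sol}_{n-1}^L(E_2)$. -/

import Mathlib

/-- A (coefficient-free) word equation `lhs = rhs` on the `n` unknowns `x_i`, `i : Fin n`. -/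
structure WordEquation (n : ℕ) where
  lhs : FreeMonoid (Fin n)
  rhs : FreeMonoid (Fin n)

namespace WordEquation

/-- The equation `u = v` is nontrivial if `u` and `v` are different words. -/
def Nontrivial {n : ℕ} (E : WordEquation n) : Prop :=
  E.lhs ≠ E.rhs

/-- The number of occurrences of the unknown `x` in the equation `u = v`,
that is, in the word `u v`. -/
def occ {n : ℕ} (E : WordEquation n) (x : Fin n) : ℕ :=
  (FreeMonoid.toList (E.lhs * E.rhs)).count x

end WordEquation

/-- The combinatorial rank of a morphism `h`: the smallest `r` for which there is a set `A` of
`r` words such that `h x ∈ A*` for every unknown `x`. -/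
noncomputable def morphismRank {n : ℕ} {α : Type*} (h : FreeMonoid (Fin n) →* FreeMonoid α) : ℕ :=
  sInf {r : ℕ | ∃ A : Finset (FreeMonoid α), A.card = r ∧
    ∀ x : Fin n, h (FreeMonoid.of x) ∈ Submonoid.closure (A : Set (FreeMonoid α))}

/-- The length type `(|h x_1|, …, |h x_n|)` of a morphism `h`. -/
def lengthType {n : ℕ} {α : Type*} (h : FreeMonoid (Fin n) →* FreeMonoid α) : Fin n → ℕ :=
  fun x => (h (FreeMonoid.of x)).length

/-- The set of solutions of rank `r` of the equation `E` over the alphabet `α`. -/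
def solRank {n : ℕ} (α : Type*) (r : ℕ) (E : WordEquation n) :
    Set (FreeMonoid (Fin n) →* FreeMonoid α) :=
  {h | h E.lhs = h E.rhs ∧ morphismRank h = r}

/-- The set of solutions of rank `r` and length type `L` of the equation `E`
over the alphabet `α`. -/
def solRankLength {n : ℕ} (α : Type*) (r : ℕ) (L : Fin n → ℕ) (E : WordEquation n) :
    Set (FreeMonoid (Fin n) →* FreeMonoid α) :=
  {h | h ∈ solRank α r E ∧ lengthType h = L}

/-- A vector of natural numbers, viewed in `ℚ^n`. -/
def toRatVec {n : ℕ} (L : Fin n → ℕ) : Fin n → ℚ :=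
  fun i => (L i : ℚ)

/-- The length types, as vectors of `ℚ^n`, of the common solutions of rank `r`
of the pair `E₁, E₂`. -/
def pairLengthTypes {n : ℕ} (α : Type*) (r : ℕ) (E₁ E₂ : WordEquation n) : Set (Fin n → ℚ) :=
  (fun h => toRatVec (lengthType h)) '' (solRank α r E₁ ∩ solRank α r E₂)

/-- `S` is covered by the union of the subspaces `V_i` of `ℚ^n`, all of dimension `d`. -/
def IsSubspaceCover {n : ℕ} {ι : Type*} (d : ℕ) (S : Set (Fin n → ℚ))
    (V : ι → Submodule ℚ (Fin n → ℚ)) : Prop :=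
  (∀ i, Module.finrank ℚ (V i) = d) ∧ S ⊆ ⋃ i, (V i : Set (Fin n → ℚ))

/-- A cover of `S` by subspaces of dimension `d` is minimal if no proper subfamily covers `S`. -/
def IsMinimalSubspaceCover {n : ℕ} {ι : Type*} (d : ℕ) (S : Set (Fin n → ℚ))
    (V : ι → Submodule ℚ (Fin n → ℚ)) : Prop :=
  IsSubspaceCover d S V ∧
    ∀ J : Set ι, S ⊆ ⋃ i ∈ J, (V i : Set (Fin n → ℚ)) → J = Set.univ

/-! Fix a length type `L` and give the unknown `x_a` the weight `X ^ L a`. Encode a word by the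
polynomials marking the positions of its letters. By the Fox chain rule, a morphism of length type
`L` solves `E` iff its vectors of letter polynomials are orthogonal to one vector `coeffVec`, which
depends only on `E` and `L`. This vector is nonzero if at most one unknown is erased, as rank `n -
1` guarantees. So if the vectors of `E₁` and `E₂` are proportional at `L`, the solutions of rank `n
- 1` and length type `L` agree (`solRankLength_eq_of_minors`).

Conversely, a common solution of rank `n - 1` factors through a code of at least `n - 1` words. The
crossed homomorphisms on the code yield that many independent vectors orthogonal to both coefficient
vectors, so all two-by-two minors vanish (`minors_eq_of_mem`).

For (a), some minor is nonzero as a polynomial in `n` commuting variables, since otherwise the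
solution sets would agree. Its positive and negative parts have exponents in `|E₁|_k + |E₁|_l`
chains each. If the parts agree after specialisation at `L`, the lowest exponents at which they
differ must cancel between a positive and a negative chain. This puts `L` on a hyperplane fixed by
the two chains (`exists_cover_of_chains`).

For (b), replacing the code words of a common solution by powers of distinct letters fills a
hyperplane of length types (`exists_parametrization`). In a minimal cover every `V i` is such a
hyperplane, and the vanishing of the minors at a generic point of it spreads to all of it
(`specialize_eq_of_mem_range`). -/

/-! ### Crossed homomorphisms on words -/

section Crossed

variable {ι κ R S : Type*} [CommSemiring R] [CommSemiring S]

/-- The crossed homomorphism on words with weights `y` and values `p` on the letters: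
`crossed y p (u v) = crossed y p u + y(u) * crossed y p v`. -/
def crossed (y p : ι → R) : List ι → R
  | [] => 0
  | a :: u => p a + y a * crossed y p u

/-- The (abelianised) Fox derivative of a word with respect to the letter `x`. -/
def foxDeriv [DecidableEq ι] (y : ι → R) (x : ι) (u : List ι) : R :=
  crossed y (fun a => if a = x then 1 else 0) u

theorem crossed_append (y p : ι → R) (u v : List ι) :
    crossed y p (u ++ v) = crossed y p u + (u.map y).prod * crossed y p v := by
  induction u with
  | nil => simp [crossed]
  | cons a u ih => simp only [List.cons_append, crossed, ih, List.map_cons, List.prod_cons]; ring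

theorem map_crossed (f : R →+* S) (y p : ι → R) (u : List ι) :
    f (crossed y p u) = crossed (fun a => f (y a)) (fun a => f (p a)) u := by
  induction u with
  | nil => simp [crossed]
  | cons a u ih => simp [crossed, ih]

theorem crossed_add (y p q : ι → R) (u : List ι) :
    crossed y (p + q) u = crossed y p u + crossed y q u := by
  induction u with
  | nil => simp [crossed]
  | cons a u ih => simp only [crossed, ih, Pi.add_apply]; ring

theorem crossed_smul (y : ι → R) (c : R) (p : ι → R) (u : List ι) :
    crossed y (c • p) u = c * crossed y p u := by
  induction u with
  | nil => simp [crossed]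
  | cons a u ih => simp only [crossed, ih, Pi.smul_apply, smul_eq_mul]; ring

theorem crossed_one (p : ι → R) (u : List ι) :
    crossed (fun _ => 1) p u = (u.map p).sum := by
  induction u with
  | nil => simp [crossed]
  | cons a u ih => simp [crossed, ih]

theorem map_foxDeriv [DecidableEq ι] (f : R →+* S) (y : ι → R) (x : ι) (u : List ι) :
    f (foxDeriv y x u) = foxDeriv (fun a => f (y a)) x u := by
  simp only [foxDeriv, map_crossed]
  congr 1
  ext a
  split_ifs <;> simp

theorem foxDeriv_nil [DecidableEq ι] (y : ι → R) (x : ι) : foxDeriv y x [] = 0 := rfl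

theorem foxDeriv_cons [DecidableEq ι] (y : ι → R) (x a : ι) (u : List ι) :
    foxDeriv y x (a :: u) = (if a = x then 1 else 0) + y a * foxDeriv y x u := rfl

theorem sum_foxDeriv_mul [Fintype ι] [DecidableEq ι] (y p : ι → R) (u : List ι) :
    ∑ x, foxDeriv y x u * p x = crossed y p u := by
  induction u with
  | nil => simp [crossed, foxDeriv_nil]
  | cons a u ih =>
    simp only [foxDeriv_cons, crossed, ← ih, add_mul, Finset.sum_add_distrib, Finset.mul_sum,
      mul_assoc]
    simp

/-- The chain rule for crossed homomorphisms. -/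
theorem crossed_map (y p : κ → R) (θ : FreeMonoid ι →* FreeMonoid κ) (u : FreeMonoid ι) :
    crossed y p (θ u).toList =
      crossed (fun x => ((θ (FreeMonoid.of x)).toList.map y).prod)
        (fun x => crossed y p (θ (FreeMonoid.of x)).toList) u.toList := by
  induction u using FreeMonoid.inductionOn' with
  | one => simp [crossed]
  | of_mul x u ih =>
    rw [map_mul, FreeMonoid.toList_mul, crossed_append, ih, FreeMonoid.toList_of_mul, crossed]

theorem prod_map_pow_const (t : R) (w : List ι) :
    (w.map fun _ => t).prod = t ^ w.length := by
  simp

theorem FreeMonoid.length_lift {α : Type*} (f : ι → FreeMonoid α) (w : FreeMonoid ι) :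
    (FreeMonoid.lift f w).length = (w.toList.map fun b => (f b).length).sum := by
  induction w using FreeMonoid.inductionOn' with
  | one => simp
  | of_mul x u ih => simp [FreeMonoid.length_mul, ih]

theorem prod_map_pow_length_lift {α : Type*} (f : ι → FreeMonoid α) (t : R) (w : FreeMonoid ι) :
    (w.toList.map fun b => t ^ (f b).length).prod = t ^ (FreeMonoid.lift f w).length := by
  induction w using FreeMonoid.inductionOn' with
  | one => simp
  | of_mul x u ih => simp [FreeMonoid.length_mul, ih, pow_add]

end Crossed

/-- The Fox derivatives with weights `X ^ L a` determine a word,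
if at most one of the numbers `L a` is zero. -/
theorem eq_of_foxDeriv_eq {ι : Type*} [DecidableEq ι] {L : ι → ℕ}
    (hL : ∀ a b, a ≠ b → L a ≠ 0 ∨ L b ≠ 0) {u v : List ι}
    (h : ∀ x, foxDeriv (fun a => (Polynomial.X : Polynomial ℕ) ^ L a) x u =
      foxDeriv (fun a => (Polynomial.X : Polynomial ℕ) ^ L a) x v) : u = v := by
  -- Coefficients in `ℕ` cannot cancel, so a word starting with `b` has a derivative by `b` with
  -- positive constant term. For a word starting with another letter of nonzero length that term is
  -- 0.
  have key : ∀ (a b : ι) (u v : List ι), a ≠ b → L a ≠ 0 →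
      foxDeriv (fun a => (Polynomial.X : Polynomial ℕ) ^ L a) b (a :: u) ≠
      foxDeriv (fun a => (Polynomial.X : Polynomial ℕ) ^ L a) b (b :: v) := by
    intro a b u v hab ha h
    have := congrArg (fun p => Polynomial.coeff p 0) h
    simp only [foxDeriv_cons, if_neg hab, if_true, Polynomial.coeff_add,
      Polynomial.mul_coeff_zero, Polynomial.coeff_X_pow, Polynomial.coeff_zero,
      Polynomial.coeff_one_zero, if_neg (Ne.symm ha)] at this
    omega
  induction u generalizing v with
  | nil =>
    cases v with
    | nil => rfl
    | cons b v =>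
      have := congrArg (fun p => Polynomial.coeff p 0) (h b)
      simp [foxDeriv_cons, foxDeriv_nil] at this
      omega
  | cons a u ih =>
    cases v with
    | nil =>
      have := congrArg (fun p => Polynomial.coeff p 0) (h a)
      simp [foxDeriv_cons, foxDeriv_nil] at this
    | cons b v =>
      by_cases hab : a = b
      · subst hab
        rw [ih fun x => ?_]
        have := h x
        rw [foxDeriv_cons, foxDeriv_cons] at this
        ext d
        have := congrArg (fun p => Polynomial.coeff p (d + L a)) this
        simpa [Polynomial.coeff_X_pow_mul] using this
      · rcases hL a b hab with ha | hb
        · exact absurd (h b) (key a b u v hab ha)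
        · exact absurd (h a).symm (key b a v u (Ne.symm hab) hb)

/-! ### Solutions in terms of Fox derivatives -/

section Solutions

variable {α : Type*} {n : ℕ}

/-- The generating polynomial of the positions of the letter `c` in a word. -/
noncomputable def letterPoly (c : α) (w : FreeMonoid α) : Polynomial ℕ :=
  open scoped Classical in foxDeriv (fun _ => Polynomial.X) c w.toList

theorem eq_of_letterPoly_eq {u v : FreeMonoid α} (h : ∀ c, letterPoly c u = letterPoly c v) :
    u = v := by
  classical
  refine FreeMonoid.toList.injective
    (eq_of_foxDeriv_eq (L := fun _ => 1) (fun _ _ _ => Or.inl one_ne_zero) fun c => ?_)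
  simpa [letterPoly] using h c

/-- The linearisation: the coefficients depend on `h` only through its length type. -/
theorem letterPoly_map (h : FreeMonoid (Fin n) →* FreeMonoid α) (c : α)
    (u : FreeMonoid (Fin n)) :
    letterPoly c (h u) = ∑ x, foxDeriv (fun a => Polynomial.X ^ lengthType h a) x u.toList *
      letterPoly c (h (FreeMonoid.of x)) := by
  classical
  rw [sum_foxDeriv_mul, letterPoly, foxDeriv, crossed_map]
  congr 1
  ext1 x
  rw [prod_map_pow_const]
  rfl

end Solutions

/-! ### Reduction of a finite set of words to a code -/

section Code

variable {α : Type*}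

/-- After cancelling common first factors, two different first factors begin the same word, so one
is a prefix of the other. -/
theorem exists_prefix_of_prod_eq {A : Set (FreeMonoid α)} (h1 : 1 ∉ A) :
    ∀ {u v : List A}, (u.map Subtype.val).prod = (v.map Subtype.val).prod → u ≠ v →
      ∃ a ∈ A, ∃ b ∈ A, ∃ c, a ≠ b ∧ b = a * c := by
  have hnil : ∀ (b : A) (v : List A), ((b :: v).map Subtype.val).prod ≠ 1 := by
    intro b v h
    have := congrArg FreeMonoid.length h
    rw [List.map_cons, List.prod_cons, FreeMonoid.length_mul, FreeMonoid.length_one] at this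
    exact h1 ((FreeMonoid.length_eq_zero.1 (Nat.eq_zero_of_add_eq_zero_right this)) ▸ b.2)
  intro u
  induction u with
  | nil =>
    intro v h hne
    cases v with
    | nil => exact absurd rfl hne
    | cons b v => exact absurd h.symm (hnil b v)
  | cons a u ih =>
    intro v h hne
    cases v with
    | nil => exact absurd h (hnil a u)
    | cons b v =>
      rw [List.map_cons, List.prod_cons, List.map_cons, List.prod_cons] at h
      by_cases hab : a = b
      · subst hab
        exact ih (mul_left_cancel h) fun e => hne (by rw [e])
      · have hab' : (a : FreeMonoid α) ≠ b := fun e => hab (Subtype.ext e)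
        rcases List.append_eq_append_iff.1 h with ⟨c, hc, -⟩ | ⟨c, hc, -⟩
        · exact ⟨a, a.2, b, b.2, c, hab', hc⟩
        · exact ⟨b, b.2, a, a.2, c, hab'.symm, hc⟩

/-- Nielsen reduction: every finite set `A` of words is contained in `B*` for a finite code `B`
such that every crossed homomorphism on `B*` is determined by its values on `A`. -/
theorem exists_code (A : Finset (FreeMonoid α)) :
    ∃ B : Finset (FreeMonoid α),
      Function.Injective (FreeMonoid.lift (Subtype.val : B → FreeMonoid α)) ∧
      (∀ a ∈ A, a ∈ Submonoid.closure (B : Set (FreeMonoid α))) ∧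
      ∀ (K : Type) [Field K] (t : K), t ≠ 0 → ∀ d : FreeMonoid α → K,
        (∀ m ∈ Submonoid.closure (B : Set (FreeMonoid α)),
          ∀ m' ∈ Submonoid.closure (B : Set (FreeMonoid α)),
            d (m * m') = d m + t ^ m.length * d m') →
        (∀ a ∈ A, d a = 0) → ∀ b ∈ B, d b = 0 := by
  classical
  -- The summand 1 makes the measure drop also when the empty word is removed.
  induction hs : ∑ a ∈ A, (a.length + 1) using Nat.strong_induction_on generalizing A with
  | _ s ih =>
  subst hs
  by_cases h1 : (1 : FreeMonoid α) ∈ A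
  · obtain ⟨B, hB, hcl, hd⟩ := ih _ (by
      rw [← Finset.sum_erase_add A _ h1]
      simp) (A.erase 1) rfl
    refine ⟨B, hB, fun a ha => ?_, fun K _ t ht d hmul hA =>
      hd K t ht d hmul fun a ha => hA a (Finset.mem_of_mem_erase ha)⟩
    by_cases ha1 : a = 1
    · exact ha1 ▸ one_mem _
    · exact hcl a (Finset.mem_erase.2 ⟨ha1, ha⟩)
  by_cases hinj : Function.Injective (FreeMonoid.lift (Subtype.val : A → FreeMonoid α))
  · exact ⟨A, hinj, fun a ha => Submonoid.subset_closure ha, fun K _ t _ d _ hA => hA⟩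
  obtain ⟨u, v, huv, hne⟩ := Function.not_injective_iff.1 hinj
  rw [FreeMonoid.lift_apply, FreeMonoid.lift_apply] at huv
  obtain ⟨a, ha, b, hb, c, hab, hbc⟩ :=
    exists_prefix_of_prod_eq (A := (A : Set (FreeMonoid α))) h1 huv hne
  have ha0 : a.length ≠ 0 := fun h => h1 (FreeMonoid.length_eq_zero.1 h ▸ ha)
  have hlen : b.length = a.length + c.length := by rw [hbc, FreeMonoid.length_mul]
  have haA : a ∈ insert c (A.erase b) :=
    Finset.mem_insert_of_mem (Finset.mem_erase.2 ⟨hab, ha⟩)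
  -- Replace `b = a * c` by `c`, which is shorter because `a` is nonempty.
  obtain ⟨B, hB, hcl, hd⟩ := ih (∑ a ∈ insert c (A.erase b), (a.length + 1)) (by
      have h := Finset.sum_erase_add A (fun a : FreeMonoid α => a.length + 1) hb
      have h' : ∑ a ∈ insert c (A.erase b), (a.length + 1) ≤
          (c.length + 1) + ∑ a ∈ A.erase b, (a.length + 1) := by
        by_cases hc : c ∈ A.erase b
        · rw [Finset.insert_eq_of_mem hc]; omega
        · rw [Finset.sum_insert hc]
      omega) (insert c (A.erase b)) rfl
  have hc := hcl c (Finset.mem_insert_self _ _)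
  refine ⟨B, hB, fun x hx => ?_, fun K _ t ht d hmul hA => hd K t ht d hmul fun x hx => ?_⟩
  · by_cases hxb : x = b
    · rw [hxb, hbc]
      exact mul_mem (hcl a haA) hc
    · exact hcl x (Finset.mem_insert_of_mem (Finset.mem_erase.2 ⟨hxb, hx⟩))
  · rcases Finset.mem_insert.1 hx with rfl | hx
    -- From `d b = d a + t ^ |a| * d c` and `t ≠ 0`, vanishing at `a` and `b` forces vanishing at
    -- `c`.
    · have := hmul a (hcl a haA) x hc
      rw [← hbc, hA a ha, hA b hb, zero_add] at this
      exact (mul_eq_zero.1 this.symm).resolve_left (pow_ne_zero _ ht)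
    · exact hA x (Finset.mem_of_mem_erase hx)

/-- Every morphism `h` factors through a free monoid over a finite code `B`, in such a way that
the crossed homomorphisms of the free monoid are determined by their values on the unknowns. -/
theorem exists_factorization {n : ℕ} (h : FreeMonoid (Fin n) →* FreeMonoid α) :
    ∃ (B : Finset (FreeMonoid α)) (θ : FreeMonoid (Fin n) →* FreeMonoid B),
      Function.Injective (FreeMonoid.lift (Subtype.val : B → FreeMonoid α)) ∧
      (∀ w, FreeMonoid.lift (Subtype.val : B → FreeMonoid α) (θ w) = h w) ∧
      ∀ (K : Type) [Field K] (t : K), t ≠ 0 → ∀ p : B → K,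
        (∀ x, crossed (fun b => t ^ b.1.length) p (θ (FreeMonoid.of x)).toList = 0) → p = 0 := by
  classical
  obtain ⟨B, hB, hcl, hd⟩ := exists_code (Finset.univ.image fun x => h (FreeMonoid.of x))
  have hmem : ∀ {w}, w ∈ Submonoid.closure (B : Set (FreeMonoid α)) ↔
      ∃ z, FreeMonoid.lift (Subtype.val : B → FreeMonoid α) z = w := by
    intro w
    rw [Submonoid.closure_eq_mrange]
    exact Iff.rfl
  have hx : ∀ x, ∃ z, FreeMonoid.lift (Subtype.val : B → FreeMonoid α) z = h (FreeMonoid.of x) :=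
    fun x => hmem.1 (hcl _ (Finset.mem_image_of_mem _ (Finset.mem_univ x)))
  choose θ hθ using hx
  refine ⟨B, FreeMonoid.lift θ, hB, fun w => ?_, fun K _ t ht p hp => ?_⟩
  · rw [← MonoidHom.comp_apply]
    congr 1
    exact FreeMonoid.hom_eq fun x => by simp [hθ]
  · set φ := FreeMonoid.lift (Subtype.val : B → FreeMonoid α) with hφ
    have hinv : ∀ z, Function.invFun φ (φ z) = z := Function.leftInverse_invFun hB
    -- Words of `B*` are decoded by `invFun`, so the product rule is available only on `B*`.
    have h0 := hd K t ht
      (fun w => crossed (fun b : B => t ^ b.1.length) p (Function.invFun φ w).toList)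
      (fun m hm m' hm' => by
        obtain ⟨z, rfl⟩ := hmem.1 hm
        obtain ⟨z', rfl⟩ := hmem.1 hm'
        rw [← map_mul, hinv, hinv, hinv, FreeMonoid.toList_mul, crossed_append,
          prod_map_pow_length_lift])
      (fun a ha => by
        obtain ⟨x, -, rfl⟩ := Finset.mem_image.1 ha
        have := hp x
        rw [FreeMonoid.lift_eval_of] at this
        rw [← hθ x, hinv, this])
    funext b
    have := h0 b b.2
    have hb : (b : FreeMonoid α) = φ (FreeMonoid.of b) := (FreeMonoid.lift_eval_of _ _).symm
    rw [hb, hinv, FreeMonoid.toList_of] at this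
    simpa [crossed] using this

theorem morphismRank_le {n : ℕ} {h : FreeMonoid (Fin n) →* FreeMonoid α}
    (A : Finset (FreeMonoid α))
    (hA : ∀ x, h (FreeMonoid.of x) ∈ Submonoid.closure (A : Set (FreeMonoid α))) :
    morphismRank h ≤ A.card :=
  Nat.sInf_le ⟨A, rfl, hA⟩

end Code

/-! ### The two-by-two minors of a pair of equations -/

section Minors

variable {α : Type*} {n : ℕ} {R S : Type*}

/-- The positive part of the `(k, l)` minor of the matrix of Fox derivatives of two equations. -/
def minorPos [CommSemiring R] (y : Fin n → R) (E₁ E₂ : WordEquation n) (k l : Fin n) : R :=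
  foxDeriv y k E₁.lhs.toList * foxDeriv y l E₂.lhs.toList +
  foxDeriv y k E₁.rhs.toList * foxDeriv y l E₂.rhs.toList +
  foxDeriv y l E₁.lhs.toList * foxDeriv y k E₂.rhs.toList +
  foxDeriv y l E₁.rhs.toList * foxDeriv y k E₂.lhs.toList

/-- The negative part of the `(k, l)` minor of the matrix of Fox derivatives of two equations. -/
def minorNeg [CommSemiring R] (y : Fin n → R) (E₁ E₂ : WordEquation n) (k l : Fin n) : R :=
  foxDeriv y k E₁.lhs.toList * foxDeriv y l E₂.rhs.toList +
  foxDeriv y k E₁.rhs.toList * foxDeriv y l E₂.lhs.toList +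
  foxDeriv y l E₁.lhs.toList * foxDeriv y k E₂.lhs.toList +
  foxDeriv y l E₁.rhs.toList * foxDeriv y k E₂.rhs.toList

theorem map_minorPos [CommSemiring R] [CommSemiring S] (f : R →+* S) (y : Fin n → R)
    (E₁ E₂ : WordEquation n) (k l : Fin n) :
    f (minorPos y E₁ E₂ k l) = minorPos (fun a => f (y a)) E₁ E₂ k l := by
  simp only [minorPos, map_add, map_mul, map_foxDeriv]

theorem map_minorNeg [CommSemiring R] [CommSemiring S] (f : R →+* S) (y : Fin n → R)
    (E₁ E₂ : WordEquation n) (k l : Fin n) :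
    f (minorNeg y E₁ E₂ k l) = minorNeg (fun a => f (y a)) E₁ E₂ k l := by
  simp only [minorNeg, map_add, map_mul, map_foxDeriv]

/-- The coefficient vector of an equation. -/
def coeffVec [CommRing R] (y : Fin n → R) (E : WordEquation n) (x : Fin n) : R :=
  foxDeriv y x E.lhs.toList - foxDeriv y x E.rhs.toList

theorem minorPos_sub_minorNeg [CommRing R] (y : Fin n → R) (E₁ E₂ : WordEquation n)
    (k l : Fin n) :
    minorPos y E₁ E₂ k l - minorNeg y E₁ E₂ k l =
      coeffVec y E₁ k * coeffVec y E₂ l - coeffVec y E₁ l * coeffVec y E₂ k := by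
  simp only [minorPos, minorNeg, coeffVec]
  ring

theorem sum_coeffVec_mul [CommRing R] (y p : Fin n → R) (E : WordEquation n) :
    ∑ x, coeffVec y E x * p x = crossed y p E.lhs.toList - crossed y p E.rhs.toList := by
  simp only [coeffVec, sub_mul, Finset.sum_sub_distrib, sum_foxDeriv_mul]

/-- The weights `X ^ L a`, as polynomials over the natural numbers. -/
noncomputable def powWeight (L : Fin n → ℕ) (a : Fin n) : Polynomial ℕ :=
  Polynomial.X ^ L a

/-- The embedding of the polynomials over `ℕ` into the polynomials over `ℤ`. -/
noncomputable def toIntPoly : Polynomial ℕ →+* Polynomial ℤ :=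
  Polynomial.mapRingHom (Nat.castRingHom ℤ)

theorem toIntPoly_injective : Function.Injective toIntPoly :=
  Polynomial.map_injective _ Nat.cast_injective

/-- The weights `X ^ L a`, as polynomials over the integers. -/
noncomputable def intWeight (L : Fin n → ℕ) (a : Fin n) : Polynomial ℤ :=
  toIntPoly (powWeight L a)

theorem intWeight_eq (L : Fin n → ℕ) (a : Fin n) : intWeight L a = Polynomial.X ^ L a := by
  simp [intWeight, powWeight, toIntPoly]

theorem coeffVec_ne_zero {E : WordEquation n} (hE : E.Nontrivial) {L : Fin n → ℕ}
    (hL : ∀ a b, a ≠ b → L a ≠ 0 ∨ L b ≠ 0) : ∃ x, coeffVec (intWeight L) E x ≠ 0 := by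
  by_contra! h
  refine hE (FreeMonoid.toList.injective (eq_of_foxDeriv_eq hL fun x => toIntPoly_injective ?_))
  have := sub_eq_zero.1 (h x)
  rw [map_foxDeriv, map_foxDeriv]
  exact this

theorem isSolution_iff (E : WordEquation n) (h : FreeMonoid (Fin n) →* FreeMonoid α) :
    h E.lhs = h E.rhs ↔ ∀ c, ∑ x, coeffVec (intWeight (lengthType h)) E x *
      toIntPoly (letterPoly c (h (FreeMonoid.of x))) = 0 := by
  have key : ∀ c, ∑ x, coeffVec (intWeight (lengthType h)) E x *
      toIntPoly (letterPoly c (h (FreeMonoid.of x))) =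
      toIntPoly (letterPoly c (h E.lhs)) - toIntPoly (letterPoly c (h E.rhs)) := by
    intro c
    rw [letterPoly_map h c E.lhs, letterPoly_map h c E.rhs]
    simp only [map_sum, map_mul, map_foxDeriv, coeffVec, sub_mul, Finset.sum_sub_distrib]
    rfl
  constructor
  · intro hE c
    rw [key, hE, sub_self]
  · intro hc
    refine eq_of_letterPoly_eq fun c => toIntPoly_injective (sub_eq_zero.1 ?_)
    rw [← key, hc]

/-- A morphism with two erased unknowns has rank at most `n - 2`. -/
theorem morphismRank_add_two_le {h : FreeMonoid (Fin n) →* FreeMonoid α} {a b : Fin n}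
    (hab : a ≠ b) (ha : lengthType h a = 0) (hb : lengthType h b = 0) :
    morphismRank h + 2 ≤ n := by
  classical
  have hle := morphismRank_le (h := h)
    (((Finset.univ.erase a).erase b).image fun x => h (FreeMonoid.of x)) (fun x => by
      by_cases hxa : x = a
      · rw [hxa, FreeMonoid.length_eq_zero.1 ha]; exact one_mem _
      by_cases hxb : x = b
      · rw [hxb, FreeMonoid.length_eq_zero.1 hb]; exact one_mem _
      refine Submonoid.subset_closure (Finset.mem_coe.2 (Finset.mem_image_of_mem _ ?_))
      simp [hxa, hxb])
  have hc := hle.trans Finset.card_image_le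
  have h1 : b ∈ Finset.univ.erase a := Finset.mem_erase.2 ⟨hab.symm, Finset.mem_univ _⟩
  have h2 := Finset.card_erase_add_one h1
  have h3 := Finset.card_erase_add_one (Finset.mem_univ a)
  rw [Finset.card_univ, Fintype.card_fin] at h3
  omega

theorem exists_lengthType_ne_zero {h : FreeMonoid (Fin n) →* FreeMonoid α}
    (hr : morphismRank h = n - 1) (a b : Fin n) (hab : a ≠ b) :
    lengthType h a ≠ 0 ∨ lengthType h b ≠ 0 := by
  by_contra! hcon
  have := morphismRank_add_two_le hab hcon.1 hcon.2
  omega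

/-- The first coefficient vector has a nonzero entry `j`. Vanishing minors make the second vector,
multiplied by that entry, a multiple of the first, so orthogonality carries over in the domain
`ℤ[X]`. -/
theorem isSolution_of_minors {E₁ E₂ : WordEquation n} (h₁ : E₁.Nontrivial)
    {h : FreeMonoid (Fin n) →* FreeMonoid α} (hr : morphismRank h = n - 1)
    (hmin : ∀ k l, k ≠ l → minorPos (powWeight (lengthType h)) E₁ E₂ k l =
      minorNeg (powWeight (lengthType h)) E₁ E₂ k l) (hE : h E₁.lhs = h E₁.rhs) :
    h E₂.lhs = h E₂.rhs := by
  obtain ⟨j, hj⟩ := coeffVec_ne_zero h₁ (exists_lengthType_ne_zero hr)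
  rw [isSolution_iff] at hE ⊢
  intro c
  refine (mul_eq_zero.1 ?_).resolve_left hj
  have hq : ∀ x, coeffVec (intWeight (lengthType h)) E₁ j *
      coeffVec (intWeight (lengthType h)) E₂ x = coeffVec (intWeight (lengthType h)) E₂ j *
      coeffVec (intWeight (lengthType h)) E₁ x := by
    intro x
    by_cases hx : j = x
    · subst hx; ring
    have h1 := congrArg toIntPoly (hmin j x hx)
    rw [map_minorPos, map_minorNeg] at h1
    have h2 := minorPos_sub_minorNeg (intWeight (lengthType h)) E₁ E₂ j x
    have h3 : minorPos (intWeight (lengthType h)) E₁ E₂ j x =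
      minorNeg (intWeight (lengthType h)) E₁ E₂ j x := h1
    rw [h3, sub_self] at h2
    linear_combination -h2
  calc _ = ∑ x, coeffVec (intWeight (lengthType h)) E₁ j *
        coeffVec (intWeight (lengthType h)) E₂ x *
        toIntPoly (letterPoly c (h (FreeMonoid.of x))) := by
        rw [Finset.mul_sum]; simp only [mul_assoc]
    _ = coeffVec (intWeight (lengthType h)) E₂ j *
        ∑ x, coeffVec (intWeight (lengthType h)) E₁ x *
        toIntPoly (letterPoly c (h (FreeMonoid.of x))) := by
        rw [Finset.mul_sum]; simp only [hq, mul_assoc]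
    _ = 0 := by rw [hE c, mul_zero]

theorem minor_eq_symm {y : Fin n → Polynomial ℕ} {E₁ E₂ : WordEquation n} {k l : Fin n}
    (h : minorPos y E₁ E₂ l k = minorNeg y E₁ E₂ l k) :
    minorPos y E₂ E₁ k l = minorNeg y E₂ E₁ k l := by
  simp only [minorPos, minorNeg] at h ⊢
  convert h using 1 <;> ring

/-- If all minors vanish at `L`, then the equations have the same solutions of rank `n - 1`
and of length type `L`. -/
theorem solRankLength_eq_of_minors {E₁ E₂ : WordEquation n} (h₁ : E₁.Nontrivial)
    (h₂ : E₂.Nontrivial) {L : Fin n → ℕ}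
    (hmin : ∀ k l, k ≠ l → minorPos (powWeight L) E₁ E₂ k l = minorNeg (powWeight L) E₁ E₂ k l) :
    solRankLength α (n - 1) L E₁ = solRankLength α (n - 1) L E₂ := by
  ext h
  constructor
  · rintro ⟨⟨hE, hr⟩, rfl⟩
    exact ⟨⟨isSolution_of_minors h₁ hr hmin hE, hr⟩, rfl⟩
  · rintro ⟨⟨hE, hr⟩, rfl⟩
    exact ⟨⟨isSolution_of_minors h₂ hr (fun k l hkl => minor_eq_symm (hmin l k hkl.symm)) hE,
      hr⟩, rfl⟩

/-! ### The minors of two equations vanish at the common solutions of rank `n - 1` -/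

/-- The linear map that assigns to values on the letters the values on the words `θ x`. -/
def crossedLin {K β : Type*} [Field K] (y : β → K)
    (θ : FreeMonoid (Fin n) →* FreeMonoid β) : (β → K) →ₗ[K] (Fin n → K) where
  toFun p x := crossed y p (θ (FreeMonoid.of x)).toList
  map_add' p q := funext fun _ => crossed_add y p q _
  map_smul' c p := funext fun _ => crossed_smul y c p _

/-- The field of fractions of the polynomials over the integers. -/
abbrev IntRatFunc : Type := FractionRing (Polynomial ℤ)

/-- The weights `X ^ L a` in the field of rational functions. -/
noncomputable def ratWeight (L : Fin n → ℕ) (a : Fin n) : IntRatFunc :=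
  algebraMap (Polynomial ℤ) IntRatFunc Polynomial.X ^ L a

theorem map_coeffVec (L : Fin n → ℕ) (E : WordEquation n) (x : Fin n) :
    algebraMap (Polynomial ℤ) IntRatFunc (coeffVec (intWeight L) E x) =
      coeffVec (ratWeight L) E x := by
  simp only [coeffVec, map_sub, map_foxDeriv, intWeight_eq, map_pow]
  rfl

theorem algebraMap_X_ne_zero :
    algebraMap (Polynomial ℤ) IntRatFunc Polynomial.X ≠ 0 := by
  rw [Ne, FaithfulSMul.algebraMap_eq_zero_iff]
  exact Polynomial.X_ne_zero

/-- A solution of `E` gives values on the unknowns that are orthogonal to the coefficient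
vector of `E`. -/
theorem sum_coeffVec_mul_crossedLin {E : WordEquation n} {B : Finset (FreeMonoid α)}
    {h : FreeMonoid (Fin n) →* FreeMonoid α} {θ : FreeMonoid (Fin n) →* FreeMonoid B}
    (hB : Function.Injective (FreeMonoid.lift (Subtype.val : B → FreeMonoid α)))
    (hθ : ∀ w, FreeMonoid.lift (Subtype.val : B → FreeMonoid α) (θ w) = h w)
    (hE : h E.lhs = h E.rhs) (p : B → IntRatFunc) :
    ∑ x, coeffVec (ratWeight (lengthType h)) E x * crossedLin
      (fun b : B => algebraMap (Polynomial ℤ) IntRatFunc Polynomial.X ^ b.1.length) θ p x = 0 := by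
  have hw : ratWeight (lengthType h) = fun x => ((θ (FreeMonoid.of x)).toList.map
      (fun b : B => algebraMap (Polynomial ℤ) IntRatFunc Polynomial.X ^ b.1.length)).prod := by
    funext x
    rw [prod_map_pow_length_lift, hθ]
    rfl
  rw [sum_coeffVec_mul, hw]
  simp only [crossedLin, LinearMap.coe_mk, AddHom.coe_mk]
  rw [← crossed_map, ← crossed_map, hB ((hθ _).trans (hE.trans (hθ _).symm)), sub_self]

theorem lift_mem_closure {B : Finset (FreeMonoid α)} (z : FreeMonoid B) :
    FreeMonoid.lift (Subtype.val : B → FreeMonoid α) z ∈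
      Submonoid.closure (B : Set (FreeMonoid α)) := by
  rw [Submonoid.closure_eq_mrange]
  exact ⟨z, rfl⟩

theorem morphismRank_le_of_factorization {B : Finset (FreeMonoid α)}
    {h : FreeMonoid (Fin n) →* FreeMonoid α} {θ : FreeMonoid (Fin n) →* FreeMonoid B}
    (hθ : ∀ w, FreeMonoid.lift (Subtype.val : B → FreeMonoid α) (θ w) = h w) :
    morphismRank h ≤ B.card :=
  morphismRank_le B fun x => hθ (FreeMonoid.of x) ▸ lift_mem_closure _

/-- A dimension count: a nonzero minor would make the span of `e_k`, `e_l` independent of the image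
of `crossedLin`, giving `|B| + 2 ≤ n`, although `|B|` is at least the rank `n - 1`. -/
theorem minors_eq_of_mem {E₁ E₂ : WordEquation n} {h : FreeMonoid (Fin n) →* FreeMonoid α}
    (hE₁ : h ∈ solRank α (n - 1) E₁) (hE₂ : h ∈ solRank α (n - 1) E₂) (k l : Fin n) :
    minorPos (powWeight (lengthType h)) E₁ E₂ k l =
      minorNeg (powWeight (lengthType h)) E₁ E₂ k l := by
  obtain ⟨B, θ, hB, hθ, hinj⟩ := exists_factorization h
  have hrank := morphismRank_le_of_factorization hθ
  rw [hE₁.2] at hrank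
  by_contra hne
  have hdet : coeffVec (ratWeight (lengthType h)) E₁ k * coeffVec (ratWeight (lengthType h)) E₂ l -
      coeffVec (ratWeight (lengthType h)) E₁ l * coeffVec (ratWeight (lengthType h)) E₂ k ≠ 0 := by
    simp only [← map_coeffVec, ← map_mul, ← map_sub]
    rw [← minorPos_sub_minorNeg, Ne, FaithfulSMul.algebraMap_eq_zero_iff, sub_eq_zero]
    intro h0
    refine hne (toIntPoly_injective ?_)
    rw [map_minorPos, map_minorNeg]
    exact h0
  set q₁ := coeffVec (ratWeight (lengthType h)) E₁
  set q₂ := coeffVec (ratWeight (lengthType h)) E₂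
  set T := crossedLin
    (fun b : B => algebraMap (Polynomial ℤ) IntRatFunc Polynomial.X ^ b.1.length) θ with hT
  have ho₁ := sum_coeffVec_mul_crossedLin hB hθ hE₁.1
  have ho₂ := sum_coeffVec_mul_crossedLin hB hθ hE₂.1
  let Ψ : ((B → IntRatFunc) × (IntRatFunc × IntRatFunc)) →ₗ[IntRatFunc] (Fin n → IntRatFunc) :=
    T.coprod ((LinearMap.single IntRatFunc (fun _ => IntRatFunc) k).coprod
      (LinearMap.single IntRatFunc (fun _ => IntRatFunc) l))
  have hΨ : Function.Injective Ψ := by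
    rw [injective_iff_map_eq_zero]
    rintro ⟨p, s, r⟩ h0
    have hval : ∀ x, T p x + ((Pi.single k s : Fin n → IntRatFunc) x +
        (Pi.single l r : Fin n → IntRatFunc) x) = 0 := fun x => congrFun h0 x
    -- Pairing with the two coefficient vectors kills `T p` and leaves a two-by-two system in `s`,
    -- `r` whose determinant is the minor.
    have hq : ∀ q : Fin n → IntRatFunc, ∑ x, q x * T p x = 0 → q k * s + q l * r = 0 := by
      intro q hq
      have : ∑ x, q x * (T p x + ((Pi.single k s : Fin n → IntRatFunc) x +
        (Pi.single l r : Fin n → IntRatFunc) x)) = 0 :=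
        Finset.sum_eq_zero fun x _ => by rw [hval, mul_zero]
      simpa [mul_add, Finset.sum_add_distrib, hq, Pi.single_apply] using this
    have e₁ := hq q₁ (ho₁ p)
    have e₂ := hq q₂ (ho₂ p)
    have hs : s = 0 := (mul_eq_zero.1 (by linear_combination q₂ l * e₁ - q₁ l * e₂ :
      (q₁ k * q₂ l - q₁ l * q₂ k) * s = 0)).resolve_left hdet
    have hr : r = 0 := (mul_eq_zero.1 (by linear_combination q₁ k * e₂ - q₂ k * e₁ :
      (q₁ k * q₂ l - q₁ l * q₂ k) * r = 0)).resolve_left hdet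
    subst hs hr
    have : p = 0 := hinj IntRatFunc _ algebraMap_X_ne_zero p fun x => by
      have hx : T p x = 0 := by simpa using hval x
      exact hx
    rw [this]
    rfl
  have := LinearMap.finrank_le_finrank_of_injective hΨ
  simp only [Module.finrank_prod, Module.finrank_fintype_fun_eq_card, Fintype.card_coe,
    Module.finrank_self, Fintype.card_fin] at this
  omega

/-- The same count with a single nonzero coefficient vector; together with the rank bound it gives
`|B| = n - 1`. -/
theorem card_add_one_le_of_factorization {E : WordEquation n} (hn : E.Nontrivial)
    {B : Finset (FreeMonoid α)}
    {h : FreeMonoid (Fin n) →* FreeMonoid α} {θ : FreeMonoid (Fin n) →* FreeMonoid B}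
    (hB : Function.Injective (FreeMonoid.lift (Subtype.val : B → FreeMonoid α)))
    (hθ : ∀ w, FreeMonoid.lift (Subtype.val : B → FreeMonoid α) (θ w) = h w)
    (hinj : ∀ (K : Type) [Field K] (t : K), t ≠ 0 → ∀ p : B → K,
        (∀ x, crossed (fun b => t ^ b.1.length) p (θ (FreeMonoid.of x)).toList = 0) → p = 0)
    (hE : h ∈ solRank α (n - 1) E) : B.card + 1 ≤ n := by
  obtain ⟨k, hk⟩ := coeffVec_ne_zero hn (exists_lengthType_ne_zero hE.2)
  have hk' : coeffVec (ratWeight (lengthType h)) E k ≠ 0 := by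
    rw [← map_coeffVec, Ne, FaithfulSMul.algebraMap_eq_zero_iff]
    exact hk
  set T := crossedLin
    (fun b : B => algebraMap (Polynomial ℤ) IntRatFunc Polynomial.X ^ b.1.length) θ with hT
  have ho := sum_coeffVec_mul_crossedLin hB hθ hE.1
  let Ψ : ((B → IntRatFunc) × IntRatFunc) →ₗ[IntRatFunc] (Fin n → IntRatFunc) :=
    T.coprod (LinearMap.single IntRatFunc (fun _ => IntRatFunc) k)
  have hΨ : Function.Injective Ψ := by
    rw [injective_iff_map_eq_zero]
    rintro ⟨p, s⟩ h0
    have hval : ∀ x, T p x + (Pi.single k s : Fin n → IntRatFunc) x = 0 :=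
      fun x => congrFun h0 x
    have hs : s = 0 := by
      have : ∑ x, coeffVec (ratWeight (lengthType h)) E x *
          (T p x + (Pi.single k s : Fin n → IntRatFunc) x) = 0 :=
        Finset.sum_eq_zero fun x _ => by rw [hval, mul_zero]
      simp only [mul_add, Finset.sum_add_distrib, hT, ho p] at this
      simpa [Pi.single_apply, hk'] using this
    subst hs
    have : p = 0 := hinj IntRatFunc _ algebraMap_X_ne_zero p fun x => by
      have hx : T p x = 0 := by simpa using hval x
      exact hx
    rw [this]
    rfl
  have := LinearMap.finrank_le_finrank_of_injective hΨ
  simpa only [Module.finrank_prod, Module.finrank_fintype_fun_eq_card, Fintype.card_coe,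
    Module.finrank_self, Fintype.card_fin] using this

end Minors

/-! ### Specialisation of exponents -/

section Specialisation

variable {n : ℕ}

/-- The pairing of a length type with an exponent vector. -/
def expPairing (L : Fin n → ℕ) (m : Fin n →₀ ℕ) : ℕ :=
  ∑ x, L x * m x

/-- Specialisation of the variables to the powers `X ^ L a`. -/
noncomputable def specialize (L : Fin n → ℕ) : MvPolynomial (Fin n) ℕ →ₐ[ℕ] Polynomial ℕ :=
  MvPolynomial.aeval (powWeight L)

theorem specialize_eq_sum (L : Fin n → ℕ) (P : MvPolynomial (Fin n) ℕ)
    {F : Finset (Fin n →₀ ℕ)} (hF : P.support ⊆ F) :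
    specialize L P = ∑ m ∈ F, Polynomial.monomial (expPairing L m) (P.coeff m) := by
  rw [specialize, MvPolynomial.aeval_def, MvPolynomial.eval₂_eq']
  refine Finset.sum_subset_zero_on_sdiff hF (fun m hm => ?_) fun m _ => ?_
  · rw [MvPolynomial.notMem_support_iff.1 (Finset.mem_sdiff.1 hm).2, map_zero]
  · simp only [powWeight, ← pow_mul, Finset.prod_pow_eq_pow_sum]
    rw [expPairing, ← Polynomial.C_mul_X_pow_eq_monomial]
    rfl

theorem coeff_specialize (L : Fin n → ℕ) (P : MvPolynomial (Fin n) ℕ)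
    {F : Finset (Fin n →₀ ℕ)} (hF : P.support ⊆ F) (e : ℕ) :
    (specialize L P).coeff e = ∑ m ∈ F with expPairing L m = e, P.coeff m := by
  rw [specialize_eq_sum L P hF, Polynomial.finsetSum_coeff, Finset.sum_filter]
  simp only [Polynomial.coeff_monomial]

theorem expPairing_mono (L : Fin n → ℕ) {m m' : Fin n →₀ ℕ} (h : m ≤ m') :
    expPairing L m ≤ expPairing L m' :=
  Finset.sum_le_sum fun x _ => Nat.mul_le_mul_left _ (h x)

/-- The functional on `ℚ^n` given by the difference of two exponent vectors. -/
def expDiff (m m' : Fin n →₀ ℕ) : (Fin n → ℚ) →ₗ[ℚ] ℚ :=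
  ∑ x, ((m x : ℚ) - (m' x : ℚ)) • LinearMap.proj x

theorem expDiff_apply (m m' : Fin n →₀ ℕ) (v : Fin n → ℚ) :
    expDiff m m' v = ∑ x, ((m x : ℚ) - (m' x : ℚ)) * v x := by
  simp [expDiff]

theorem expDiff_toRatVec (m m' : Fin n →₀ ℕ) (L : Fin n → ℕ) :
    expDiff m m' (toRatVec L) = (expPairing L m : ℚ) - (expPairing L m' : ℚ) := by
  simp only [expDiff_apply, expPairing, toRatVec, sub_mul, Finset.sum_sub_distrib]
  push_cast
  simp only [mul_comm]

theorem expDiff_toRatVec_eq_zero {m m' : Fin n →₀ ℕ} {L : Fin n → ℕ} :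
    expDiff m m' (toRatVec L) = 0 ↔ expPairing L m = expPairing L m' := by
  rw [expDiff_toRatVec, sub_eq_zero, Nat.cast_inj]

theorem finrank_ker_of_ne_zero {f : (Fin n → ℚ) →ₗ[ℚ] ℚ} (hf : f ≠ 0) :
    Module.finrank ℚ (LinearMap.ker f) = n - 1 := by
  have := Module.Dual.finrank_ker_add_one_of_ne_zero (f := f) hf
  rw [Module.finrank_fin_fun] at this
  omega

theorem exists_hyperplane (hn : 0 < n) (m m' : Fin n →₀ ℕ) :
    ∃ V : Submodule ℚ (Fin n → ℚ), Module.finrank ℚ V = n - 1 ∧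
      (m ≠ m' → ∀ L : Fin n → ℕ, expPairing L m = expPairing L m' → toRatVec L ∈ V) := by
  by_cases h : m = m'
  -- A filler hyperplane, so that every pair of exponents has one of the right dimension.
  · refine ⟨LinearMap.ker (LinearMap.proj ⟨0, hn⟩), finrank_ker_of_ne_zero fun h0 => ?_,
      fun h' => absurd h h'⟩
    have := congrArg (fun f : (Fin n → ℚ) →ₗ[ℚ] ℚ => f (fun _ => 1)) h0
    simp at this
  · refine ⟨LinearMap.ker (expDiff m m'), finrank_ker_of_ne_zero fun h0 => h ?_,
      fun _ L hL => expDiff_toRatVec_eq_zero.2 hL⟩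
    ext x
    have := congrArg (fun f : (Fin n → ℚ) →ₗ[ℚ] ℚ => f (Pi.single x 1)) h0
    simp only [expDiff_apply, Pi.single_apply, mul_ite, mul_one, mul_zero, Finset.sum_ite_eq',
      Finset.mem_univ, if_true, LinearMap.zero_apply] at this
    exact_mod_cast sub_eq_zero.1 this

/-! ### Covering the zeros of a difference of sums over chains -/

/-- This lets the hyperplanes be chosen before `L`. The value 0 is a default for chains without an
element satisfying `p`. -/
theorem exists_least_of_chain {C : Set (Fin n →₀ ℕ)} (hC : ∀ m ∈ C, ∀ m' ∈ C, m ≤ m' ∨ m' ≤ m)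
    (p : (Fin n →₀ ℕ) → Prop) :
    ∃ m₀, ∀ m ∈ C, p m → m₀ ≤ m ∧ p m₀ := by
  by_cases h : ∃ m, m ∈ C ∧ p m
  · obtain ⟨m₀, ⟨h1, h2⟩, hmin⟩ := exists_minimal_of_wellFoundedLT (fun m => m ∈ C ∧ p m) h
    refine ⟨m₀, fun m hm hpm => ⟨?_, h2⟩⟩
    rcases hC m₀ h1 m hm with hle | hle
    · exact hle
    · exact hmin ⟨hm, hpm⟩ hle
  · exact ⟨0, fun m hm hpm => absurd ⟨m, hm, hpm⟩ h⟩

/-- If the exponents of `P` and of `Q` lie in unions of chains, then the length types at which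
`P ≠ Q` specialise to the same polynomial are covered by one hyperplane for each pair of
chains. -/
theorem exists_cover_of_chains {ι κ : Type*} {P Q : MvPolynomial (Fin n) ℕ} (hPQ : P ≠ Q)
    (hn : 0 < n) (C : ι → Set (Fin n →₀ ℕ)) (D : κ → Set (Fin n →₀ ℕ))
    (hC : ∀ i, ∀ m ∈ C i, ∀ m' ∈ C i, m ≤ m' ∨ m' ≤ m)
    (hD : ∀ i, ∀ m ∈ D i, ∀ m' ∈ D i, m ≤ m' ∨ m' ≤ m)
    (hP : ∀ m, P.coeff m ≠ 0 → ∃ i, m ∈ C i) (hQ : ∀ m, Q.coeff m ≠ 0 → ∃ i, m ∈ D i) :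
    ∃ V : ι × κ → Submodule ℚ (Fin n → ℚ), (∀ i, Module.finrank ℚ (V i) = n - 1) ∧
      ∀ L : Fin n → ℕ, specialize L P = specialize L Q → ∃ i, toRatVec L ∈ V i := by
  classical
  choose f hf using fun i => exists_least_of_chain (hC i) fun m => Q.coeff m < P.coeff m
  choose g hg using fun i => exists_least_of_chain (hD i) fun m => P.coeff m < Q.coeff m
  choose V hV hmem using fun i : ι × κ => exists_hyperplane hn (f i.1) (g i.2)
  refine ⟨V, hV, fun L hL => ?_⟩
  set F := P.support ∪ Q.support with hFdef
  have hF : ∀ m, P.coeff m ≠ Q.coeff m → m ∈ F := by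
    intro m hm
    by_contra hmF
    rw [hFdef, Finset.mem_union, not_or, MvPolynomial.notMem_support_iff,
      MvPolynomial.notMem_support_iff] at hmF
    exact hm (hmF.1.trans hmF.2.symm)
  obtain ⟨m₀, hm₀, hmin⟩ := exists_minimalFor_of_wellFoundedLT
    (fun m => P.coeff m ≠ Q.coeff m) (expPairing L) (by
      by_contra! h
      exact hPQ (MvPolynomial.ext _ _ h))
  have hmin' : ∀ m, P.coeff m ≠ Q.coeff m → expPairing L m₀ ≤ expPairing L m := by
    intro m hm
    by_contra! hlt
    exact absurd (hmin hm hlt.le) (not_le.2 hlt)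
  have hsum : ∑ m ∈ F with expPairing L m = expPairing L m₀, P.coeff m =
      ∑ m ∈ F with expPairing L m = expPairing L m₀, Q.coeff m := by
    rw [← coeff_specialize L P Finset.subset_union_left,
      ← coeff_specialize L Q Finset.subset_union_right, hL]
  have hm₀F : m₀ ∈ F.filter fun m => expPairing L m = expPairing L m₀ :=
    Finset.mem_filter.2 ⟨hF m₀ hm₀, rfl⟩
  -- The two sums agree but their terms differ at `m₀`, so differences of both signs occur at this
  -- level.
  have hplus : ∃ m, expPairing L m = expPairing L m₀ ∧ Q.coeff m < P.coeff m := by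
    by_contra! h
    refine absurd hsum (ne_of_lt (Finset.sum_lt_sum (fun m hm => h m (Finset.mem_filter.1 hm).2)
      ⟨m₀, hm₀F, lt_of_le_of_ne (h m₀ rfl) hm₀⟩))
  have hminus : ∃ m, expPairing L m = expPairing L m₀ ∧ P.coeff m < Q.coeff m := by
    by_contra! h
    refine absurd hsum (ne_of_gt (Finset.sum_lt_sum (fun m hm => h m (Finset.mem_filter.1 hm).2)
      ⟨m₀, hm₀F, lt_of_le_of_ne (h m₀ rfl) hm₀.symm⟩))
  obtain ⟨m, hm, hlt⟩ := hplus
  obtain ⟨m', hm', hlt'⟩ := hminus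
  obtain ⟨i, hi⟩ := hP m (by omega)
  obtain ⟨j, hj⟩ := hQ m' (by omega)
  obtain ⟨hle, hfi⟩ := hf i m hi hlt
  obtain ⟨hle', hgj⟩ := hg j m' hj hlt'
  -- The least differing element of the chain pairs no higher than `m`, and minimality of `m₀`
  -- forces equality.
  have e1 : expPairing L (f i) = expPairing L m₀ :=
    le_antisymm ((expPairing_mono L hle).trans hm.le) (hmin' _ hfi.ne')
  have e2 : expPairing L (g j) = expPairing L m₀ :=
    le_antisymm ((expPairing_mono L hle').trans hm'.le) (hmin' _ hgj.ne)
  refine ⟨(i, j), hmem (i, j) (fun h => ?_) L (e1.trans e2.symm)⟩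
  have h' : f i = g j := h
  rw [h'] at hfi
  omega

end Specialisation

/-! ### The chains of exponents of a word -/

section Positions

variable {n : ℕ}

/-- The exponent vectors of the prefixes of `u` that precede an occurrence of `x`. -/
noncomputable def positions (x : Fin n) : List (Fin n) → List (Fin n →₀ ℕ)
  | [] => []
  | a :: u => (if a = x then [0] else []) ++ (positions x u).map (Finsupp.single a 1 + ·)

theorem length_positions (x : Fin n) (u : List (Fin n)) :
    (positions x u).length = u.count x := by
  induction u with
  | nil => rfl
  | cons a u ih =>
    rw [positions, List.length_append, List.length_map, ih, List.count_cons]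
    by_cases h : a = x <;> simp [h, add_comm]

/-- Prefixes of one word are nested, so their exponent vectors are comparable. -/
theorem positions_chain (x : Fin n) (u : List (Fin n)) :
    ∀ m ∈ positions x u, ∀ m' ∈ positions x u, m ≤ m' ∨ m' ≤ m := by
  induction u with
  | nil => simp [positions]
  | cons a u ih =>
    have key : ∀ m ∈ positions x (a :: u), m = 0 ∨
        ∃ m' ∈ positions x u, m = Finsupp.single a 1 + m' := by
      intro m hm
      rw [positions, List.mem_append, List.mem_map] at hm
      rcases hm with hm | ⟨m', hm', rfl⟩
      · left
        split_ifs at hm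
        · simpa using hm
        · simp at hm
      · exact Or.inr ⟨m', hm', rfl⟩
    intro m hm m' hm'
    rcases key m hm with rfl | ⟨w, hw, rfl⟩
    · exact Or.inl zero_le
    rcases key m' hm' with rfl | ⟨w', hw', rfl⟩
    · exact Or.inr zero_le
    rcases ih w hw w' hw' with h | h
    · exact Or.inl (add_le_add_right h _)
    · exact Or.inr (add_le_add_right h _)

theorem mem_positions_of_mem_support (x : Fin n) (u : List (Fin n)) {m : Fin n →₀ ℕ}
    (hm : m ∈ (foxDeriv (MvPolynomial.X : Fin n → MvPolynomial (Fin n) ℕ) x u).support) :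
    m ∈ positions x u := by
  classical
  induction u generalizing m with
  | nil => simp [foxDeriv_nil] at hm
  | cons a u ih =>
    rw [foxDeriv_cons] at hm
    rw [positions, List.mem_append]
    rcases Finset.mem_union.1 (MvPolynomial.support_add hm) with hm | hm
    · left
      split_ifs at hm ⊢
      · have : m = 0 := by
          by_contra h
          rw [MvPolynomial.mem_support_iff, MvPolynomial.coeff_one, if_neg (Ne.symm h)] at hm
          exact hm rfl
        simpa using this
      · simp at hm
    · right
      obtain ⟨m₁, h₁, m₂, h₂, rfl⟩ := Finset.mem_add.1 (MvPolynomial.support_mul _ _ hm)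
      rw [MvPolynomial.support_X, Finset.mem_singleton] at h₁
      exact List.mem_map.2 ⟨m₂, ih h₂, by rw [h₁]⟩

/-- The chains `e + positions y v`, where `e` runs over the positions of `x` in `u`. -/
noncomputable def shiftedChains (x : Fin n) (u : List (Fin n)) (y : Fin n) (v : List (Fin n)) :
    List (Set (Fin n →₀ ℕ)) :=
  (positions x u).map fun e => {m | ∃ m' ∈ positions y v, m = e + m'}

theorem length_shiftedChains (x : Fin n) (u : List (Fin n)) (y : Fin n) (v : List (Fin n)) :
    (shiftedChains x u y v).length = u.count x := by
  rw [shiftedChains, List.length_map, length_positions]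

theorem chain_of_mem_shiftedChains {x : Fin n} {u : List (Fin n)} {y : Fin n}
    {v : List (Fin n)} {C : Set (Fin n →₀ ℕ)} (hC : C ∈ shiftedChains x u y v) :
    ∀ m ∈ C, ∀ m' ∈ C, m ≤ m' ∨ m' ≤ m := by
  obtain ⟨e, -, rfl⟩ := List.mem_map.1 hC
  rintro _ ⟨m, hm, rfl⟩ _ ⟨m', hm', rfl⟩
  rcases positions_chain y v m hm m' hm' with h | h
  · exact Or.inl (add_le_add_right h _)
  · exact Or.inr (add_le_add_right h _)

theorem exists_mem_shiftedChains (x : Fin n) (u : List (Fin n)) (y : Fin n) (v : List (Fin n))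
    {m : Fin n →₀ ℕ}
    (hm : m ∈ (foxDeriv (MvPolynomial.X : Fin n → MvPolynomial (Fin n) ℕ) x u *
      foxDeriv MvPolynomial.X y v).support) : ∃ C ∈ shiftedChains x u y v, m ∈ C := by
  classical
  obtain ⟨e, he, m', hm', rfl⟩ := Finset.mem_add.1 (MvPolynomial.support_mul _ _ hm)
  exact ⟨_, List.mem_map.2 ⟨e, mem_positions_of_mem_support x u he, rfl⟩, m',
    mem_positions_of_mem_support y v hm', rfl⟩

/-- Each occurrence counted in the left factors gives one chain, running along the word of the right
factor. For the minors the left factors come from `E₁`, so only its occurrences enter the bound. -/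
theorem exists_chains_of_sum {N : ℕ} {x₁ x₂ x₃ x₄ y₁ y₂ y₃ y₄ : Fin n}
    {u₁ u₂ u₃ u₄ v₁ v₂ v₃ v₄ : List (Fin n)}
    (hN : u₁.count x₁ + u₂.count x₂ + u₃.count x₃ + u₄.count x₄ = N)
    {P : MvPolynomial (Fin n) ℕ}
    (hP : P = foxDeriv MvPolynomial.X x₁ u₁ * foxDeriv MvPolynomial.X y₁ v₁ +
      foxDeriv MvPolynomial.X x₂ u₂ * foxDeriv MvPolynomial.X y₂ v₂ +
      foxDeriv MvPolynomial.X x₃ u₃ * foxDeriv MvPolynomial.X y₃ v₃ +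
      foxDeriv MvPolynomial.X x₄ u₄ * foxDeriv MvPolynomial.X y₄ v₄) :
    ∃ C : Fin N → Set (Fin n →₀ ℕ),
      (∀ i, ∀ m ∈ C i, ∀ m' ∈ C i, m ≤ m' ∨ m' ≤ m) ∧ ∀ m, P.coeff m ≠ 0 → ∃ i, m ∈ C i := by
  classical
  set l := shiftedChains x₁ u₁ y₁ v₁ ++ shiftedChains x₂ u₂ y₂ v₂ ++
    shiftedChains x₃ u₃ y₃ v₃ ++ shiftedChains x₄ u₄ y₄ v₄ with hl
  have hlen : l.length = N := by
    simp only [hl, List.length_append, length_shiftedChains, hN]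
  subst hlen
  refine ⟨l.get, fun i => ?_, fun m hm => ?_⟩
  · have hmem : ∀ C ∈ l, ∀ m ∈ C, ∀ m' ∈ C, m ≤ m' ∨ m' ≤ m := by
      intro C hC
      simp only [hl, List.mem_append] at hC
      rcases hC with ((h | h) | h) | h <;> exact chain_of_mem_shiftedChains h
    exact hmem _ (List.get_mem l i)
  · suffices ∃ C ∈ l, m ∈ C by
      obtain ⟨C, hC, hmC⟩ := this
      obtain ⟨i, rfl⟩ := List.mem_iff_get.1 hC
      exact ⟨i, hmC⟩
    rw [← MvPolynomial.mem_support_iff, hP] at hm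
    simp only [hl, List.mem_append]
    rcases Finset.mem_union.1 (MvPolynomial.support_add hm) with hm | hm
    · rcases Finset.mem_union.1 (MvPolynomial.support_add hm) with hm | hm
      · rcases Finset.mem_union.1 (MvPolynomial.support_add hm) with hm | hm
        · obtain ⟨C, hC, h⟩ := exists_mem_shiftedChains _ _ _ _ hm
          exact ⟨C, by simp [hC], h⟩
        · obtain ⟨C, hC, h⟩ := exists_mem_shiftedChains _ _ _ _ hm
          exact ⟨C, by simp [hC], h⟩
      · obtain ⟨C, hC, h⟩ := exists_mem_shiftedChains _ _ _ _ hm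
        exact ⟨C, by simp [hC], h⟩
    · obtain ⟨C, hC, h⟩ := exists_mem_shiftedChains _ _ _ _ hm
      exact ⟨C, by simp [hC], h⟩

/-! ### Specialised minors and part (a) -/

theorem specialize_minorPos (L : Fin n → ℕ) (E₁ E₂ : WordEquation n) (k l : Fin n) :
    specialize L (minorPos MvPolynomial.X E₁ E₂ k l) = minorPos (powWeight L) E₁ E₂ k l := by
  have := map_minorPos (specialize L : MvPolynomial (Fin n) ℕ →+* Polynomial ℕ)
    MvPolynomial.X E₁ E₂ k l
  simpa [specialize] using this

theorem specialize_minorNeg (L : Fin n → ℕ) (E₁ E₂ : WordEquation n) (k l : Fin n) :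
    specialize L (minorNeg MvPolynomial.X E₁ E₂ k l) = minorNeg (powWeight L) E₁ E₂ k l := by
  have := map_minorNeg (specialize L : MvPolynomial (Fin n) ℕ →+* Polynomial ℕ)
    MvPolynomial.X E₁ E₂ k l
  simpa [specialize] using this

theorem occ_add_occ (E : WordEquation n) (k l : Fin n) :
    E.lhs.toList.count k + E.rhs.toList.count k + E.lhs.toList.count l + E.rhs.toList.count l =
      E.occ k + E.occ l := by
  simp only [WordEquation.occ, FreeMonoid.toList_mul, List.count_append]
  omega

/-- The length types of the common solutions of rank `n - 1` are covered by few hyperplanes. -/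
theorem exists_subspaceCover {α : Type*} {E₁ E₂ : WordEquation n} (h₁ : E₁.Nontrivial)
    (h₂ : E₂.Nontrivial) (hne : solRank α (n - 1) E₁ ≠ solRank α (n - 1) E₂) :
    ∃ k l : Fin n, k ≠ l ∧
      ∃ V : Fin ((E₁.occ k + E₁.occ l) ^ 2) → Submodule ℚ (Fin n → ℚ),
        IsSubspaceCover (n - 1) (pairLengthTypes α (n - 1) E₁ E₂) V := by
  obtain ⟨k, l, hkl, hD⟩ : ∃ k l : Fin n, k ≠ l ∧
      minorPos (MvPolynomial.X : Fin n → MvPolynomial (Fin n) ℕ) E₁ E₂ k l ≠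
        minorNeg MvPolynomial.X E₁ E₂ k l := by
    by_contra! h
    have hL : ∀ L, solRankLength α (n - 1) L E₁ = solRankLength α (n - 1) L E₂ := fun L =>
      solRankLength_eq_of_minors h₁ h₂ fun k l hkl => by
        rw [← specialize_minorPos, ← specialize_minorNeg, h k l hkl]
    refine hne (Set.ext fun h => ?_)
    have := Set.ext_iff.1 (hL (lengthType h)) h
    simpa [solRankLength] using this
  refine ⟨k, l, hkl, ?_⟩
  obtain ⟨C, hC, hP⟩ := exists_chains_of_sum (occ_add_occ E₁ k l)
    (P := minorPos MvPolynomial.X E₁ E₂ k l) rfl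
  obtain ⟨D, hD', hQ⟩ := exists_chains_of_sum (occ_add_occ E₁ k l)
    (P := minorNeg MvPolynomial.X E₁ E₂ k l) rfl
  obtain ⟨V, hV, hcov⟩ := exists_cover_of_chains hD (Fin.pos k) C D hC hD' hP hQ
  have e : Fin ((E₁.occ k + E₁.occ l) ^ 2) ≃ Fin (E₁.occ k + E₁.occ l) × Fin (E₁.occ k + E₁.occ l) :=
    (finCongr (pow_two _)).trans finProdFinEquiv.symm
  refine ⟨V ∘ e, fun i => hV _, ?_⟩
  rintro _ ⟨h, ⟨hh₁, hh₂⟩, rfl⟩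
  obtain ⟨i, hi⟩ := hcov (lengthType h) (by
    rw [specialize_minorPos, specialize_minorNeg, minors_eq_of_mem hh₁ hh₂])
  exact Set.mem_iUnion.2 ⟨e.symm i, by simpa using hi⟩

end Positions

/-! ### Solutions of rank `n - 1` in a whole hyperplane of length types -/

section Parametrization

variable {α : Type*} {n : ℕ}

/-- Finitely many proper subspaces do not cover the vectors of positive integers. -/
theorem exists_pos_notMem {m : ℕ} {ι : Type*} [Finite ι] (W : ι → Submodule ℚ (Fin m → ℚ))
    (hW : ∀ i, W i ≠ ⊤) : ∃ N : Fin m → ℕ, (∀ j, 0 < N j) ∧ ∀ i, toRatVec N ∉ W i := by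
  classical
  cases nonempty_fintype ι
  choose f hf hle using fun i => Submodule.exists_le_ker_of_lt_top (W i) (lt_top_iff_ne_top.2 (hW i))
  -- A nonzero functional restricted to the moment curve `(1, s, s², …)` is a nonzero polynomial in
  -- `s`, with finitely many roots.
  let Q : ι → Polynomial ℚ := fun i =>
    ∑ j : Fin m, Polynomial.monomial (j : ℕ) (f i (Pi.single j 1))
  have hQ : ∀ i, Q i ≠ 0 := by
    intro i h0
    refine hf i (LinearMap.pi_ext' fun j => LinearMap.ext_ring ?_)
    have := congrArg (fun p => Polynomial.coeff p (j : ℕ)) h0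
    simpa [Q, Polynomial.coeff_monomial, Fin.val_inj] using this
  have hprod : ∏ i, Q i ≠ 0 := Finset.prod_ne_zero_iff.2 fun i _ => hQ i
  obtain ⟨s, hs⟩ := Set.Infinite.exists_notMem_finset
    (Set.infinite_range_of_injective (f := fun k : ℕ => ((k + 1 : ℕ) : ℚ))
      (fun a b h => by simpa using h)) (∏ i, Q i).roots.toFinset
  obtain ⟨⟨s, rfl⟩, hs⟩ := hs
  refine ⟨fun j => (s + 1) ^ (j : ℕ), fun j => by positivity, fun i hi => hs ?_⟩
  rw [Multiset.mem_toFinset, Polynomial.mem_roots hprod, Polynomial.IsRoot, Polynomial.eval_prod]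
  refine Finset.prod_eq_zero (Finset.mem_univ i) ?_
  have h0 := LinearMap.mem_ker.1 (hle i hi)
  rw [LinearMap.pi_apply_eq_sum_univ] at h0
  rw [← h0]
  simp only [Q, Polynomial.eval_finsetSum, Polynomial.eval_monomial, toRatVec, smul_eq_mul]
  refine Finset.sum_congr rfl fun j _ => ?_
  push_cast
  rw [mul_comm]
  congr 2
  ext x
  simp [Pi.single_apply, eq_comm]

theorem mem_closure_image_of {C : Finset α} [DecidableEq (FreeMonoid α)] {w : FreeMonoid α}
    (hw : ∀ c ∈ w.toList, c ∈ C) :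
    w ∈ Submonoid.closure ((C.image FreeMonoid.of : Finset (FreeMonoid α)) :
      Set (FreeMonoid α)) := by
  induction w using FreeMonoid.inductionOn' with
  | one => exact one_mem _
  | of_mul c w ih =>
    rw [FreeMonoid.toList_of_mul] at hw
    exact mul_mem (Submonoid.subset_closure (Finset.mem_coe.2 (Finset.mem_image_of_mem _
      (hw c List.mem_cons_self)))) (ih fun c' hc' => hw c' (List.mem_cons_of_mem _ hc'))

/-- The letters occurring in the images generate them, so there are at least as many as the rank.
They provide the distinct letters for the substitution. -/
theorem exists_letters (h : FreeMonoid (Fin n) →* FreeMonoid α) :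
    ∃ c : Fin (morphismRank h) → α, Function.Injective c := by
  classical
  set C : Finset α := Finset.univ.biUnion fun x => (h (FreeMonoid.of x)).toList.toFinset with hC
  have hle : morphismRank h ≤ C.card :=
    (morphismRank_le (C.image FreeMonoid.of) fun x => mem_closure_image_of fun c hc =>
      Finset.mem_biUnion.2 ⟨x, Finset.mem_univ x, List.mem_toFinset.2 hc⟩).trans
      Finset.card_image_le
  exact ⟨fun j => C.equivFin.symm (Fin.castLE hle j), fun i j hij => by
    simpa using Subtype.ext hij⟩

theorem crossed_one_of_pow (p : α → ℚ) (c : α) (N : ℕ) :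
    crossed (fun _ => 1) p (FreeMonoid.of c ^ N).toList = N * p c := by
  induction N with
  | zero => simp [crossed]
  | succ N ih =>
    rw [pow_succ, FreeMonoid.toList_mul, crossed_append, ih, FreeMonoid.toList_of]
    simp [crossed]
    ring

theorem length_of_pow (c : α) (N : ℕ) : (FreeMonoid.of c ^ N).length = N := by
  induction N with
  | zero => simp
  | succ N ih => rw [pow_succ, FreeMonoid.length_mul, ih, FreeMonoid.length_of]

theorem crossed_one_eq_zero_of_mem_closure {A : Set (FreeMonoid α)} {p : α → ℚ}
    (hA : ∀ a ∈ A, crossed (fun _ => 1) p a.toList = 0) {w : FreeMonoid α}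
    (hw : w ∈ Submonoid.closure A) : crossed (fun _ => 1) p w.toList = 0 := by
  induction hw using Submonoid.closure_induction with
  | mem a ha => exact hA a ha
  | one => simp [crossed]
  | mul u v _ _ hu hv => rw [FreeMonoid.toList_mul, crossed_append, hu, hv]; simp

theorem exists_morphismRank_eq_card (h : FreeMonoid (Fin n) →* FreeMonoid α) :
    ∃ A : Finset (FreeMonoid α), A.card = morphismRank h ∧
      ∀ x : Fin n, h (FreeMonoid.of x) ∈ Submonoid.closure (A : Set (FreeMonoid α)) := by
  classical
  exact Nat.sInf_mem (s := {r : ℕ | ∃ A : Finset (FreeMonoid α), A.card = r ∧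
    ∀ x : Fin n, h (FreeMonoid.of x) ∈ Submonoid.closure (A : Set (FreeMonoid α))})
    ⟨_, Finset.univ.image fun x => h (FreeMonoid.of x), rfl, fun x =>
      Submonoid.subset_closure (Finset.mem_coe.2 (Finset.mem_image_of_mem _ (Finset.mem_univ x)))⟩

/-- The crossed homomorphism at a given word, as a linear function of the values on the letters. -/
def crossedAt {K β : Type*} [Field K] (y : β → K) (w : List β) : (β → K) →ₗ[K] K where
  toFun p := crossed y p w
  map_add' p q := crossed_add y p q w
  map_smul' r p := crossed_smul y r p w

/-- The values `p b / N b` on the letters `c b`, extended by zero. -/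
noncomputable def letterWeight {β : Type*} [Fintype β] [DecidableEq α] (c : β → α) (N : β → ℕ) :
    (β → ℚ) →ₗ[ℚ] (α → ℚ) where
  toFun p a := ∑ b, if c b = a then p b / N b else 0
  map_add' p q := by
    ext a
    simp only [Pi.add_apply, ← Finset.sum_add_distrib]
    refine Finset.sum_congr rfl fun b _ => ?_
    split_ifs <;> ring
  map_smul' r p := by
    ext a
    simp only [Pi.smul_apply, smul_eq_mul, Finset.mul_sum, RingHom.id_apply]
    refine Finset.sum_congr rfl fun b _ => ?_
    split_ifs <;> ring

/-- Substituting powers of distinct letters into `θ` gives a morphism of full rank, if the additive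
functions are determined by their values on the words `θ x`. -/
theorem morphismRank_lift_pow {β : Type*} [Fintype β] {θ : FreeMonoid (Fin n) →* FreeMonoid β}
    (hθ : ∀ p : β → ℚ, (∀ x, crossed (fun _ => 1) p (θ (FreeMonoid.of x)).toList = 0) → p = 0)
    {c : β → α} (hc : Function.Injective c) {N : β → ℕ} (hN : ∀ b, 0 < N b) :
    morphismRank ((FreeMonoid.lift fun b => FreeMonoid.of (c b) ^ N b).comp θ) =
      Fintype.card β := by
  classical
  set φ := FreeMonoid.lift fun b => FreeMonoid.of (c b) ^ N b with hφ
  apply le_antisymm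
  · refine (morphismRank_le (Finset.univ.image fun b => FreeMonoid.of (c b) ^ N b)
      fun x => ?_).trans (Finset.card_image_le.trans Finset.card_univ.le)
    rw [MonoidHom.comp_apply]
    generalize θ (FreeMonoid.of x) = z
    induction z using FreeMonoid.inductionOn' with
    | one => rw [map_one]; exact one_mem _
    | of_mul b z ih =>
      rw [map_mul]
      refine mul_mem (Submonoid.subset_closure (Finset.mem_coe.2 ?_)) ih
      rw [hφ, FreeMonoid.lift_eval_of]
      exact Finset.mem_image.2 ⟨b, Finset.mem_univ b, rfl⟩
  · obtain ⟨A, hA, hcl⟩ := exists_morphismRank_eq_card (φ.comp θ)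
    rw [← hA]
    set ext := letterWeight c N with hextdef
    have hext : ∀ p b, N b * ext p (c b) = p b := by
      intro p b
      have hNb : (N b : ℚ) ≠ 0 := Nat.cast_ne_zero.2 (hN b).ne'
      simp only [hextdef, letterWeight, LinearMap.coe_mk, AddHom.coe_mk, hc.eq_iff, Finset.sum_ite_eq',
        Finset.mem_univ, if_true]
      field_simp
    -- An additive function that vanishes on `A` vanishes on all images of unknowns, hence is zero;
    -- so `A` has at least `|β|` elements.
    let Φ : (β → ℚ) →ₗ[ℚ] (A → ℚ) :=
      LinearMap.pi fun a => (crossedAt (fun _ => 1) a.1.toList).comp ext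
    have hΦ : Function.Injective Φ := by
      rw [injective_iff_map_eq_zero]
      intro p hp
      refine hθ p fun x => ?_
      have hA0 : ∀ a ∈ (A : Set (FreeMonoid α)), crossed (fun _ => 1) (ext p) a.toList = 0 :=
        fun a ha => congrFun hp ⟨a, ha⟩
      have h0 := crossed_one_eq_zero_of_mem_closure hA0 (hcl x)
      rw [MonoidHom.comp_apply, crossed_map] at h0
      rw [← h0]
      congr 1
      · simp
      · funext b
        rw [hφ, FreeMonoid.lift_eval_of, crossed_one_of_pow, hext]
    simpa using LinearMap.finrank_le_finrank_of_injective hΦ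

/-- The length type of a common solution of rank `n - 1` lies in a hyperplane, parametrised by `T`,
in which all positive integral parameters give length types of common solutions of rank `n - 1`. -/
theorem exists_parametrization {E₁ E₂ : WordEquation n} (h₁ : E₁.Nontrivial)
    {h : FreeMonoid (Fin n) →* FreeMonoid α} (hE₁ : h ∈ solRank α (n - 1) E₁)
    (hE₂ : h ∈ solRank α (n - 1) E₂) :
    ∃ T : (Fin (n - 1) → ℚ) →ₗ[ℚ] (Fin n → ℚ), Function.Injective T ∧
      toRatVec (lengthType h) ∈ LinearMap.range T ∧
      ∀ N : Fin (n - 1) → ℕ, (∀ j, 0 < N j) →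
        ∃ h' ∈ solRank α (n - 1) E₁ ∩ solRank α (n - 1) E₂,
          T (toRatVec N) = toRatVec (lengthType h') := by
  obtain ⟨B, θ, hB, hθ, hinj⟩ := exists_factorization h
  have hcard : Fintype.card B = n - 1 := by
    rw [Fintype.card_coe]
    have h1 := morphismRank_le_of_factorization hθ
    have h2 := card_add_one_le_of_factorization h₁ hB hθ hinj hE₁
    rw [hE₁.2] at h1
    omega
  -- At `t = 1` crossed homomorphisms become additive functions, such as lengths.
  have hinj' : ∀ p : B → ℚ,
      (∀ x, crossed (fun _ => 1) p (θ (FreeMonoid.of x)).toList = 0) → p = 0 := fun p hp =>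
    hinj ℚ 1 one_ne_zero p (by simpa using hp)
  have e : B ≃ Fin (n - 1) := Fintype.equivFinOfCardEq hcard
  obtain ⟨c, hc⟩ : ∃ c : Fin (n - 1) → α, Function.Injective c := hE₁.2 ▸ exists_letters h
  have hT : ∀ (N : Fin (n - 1) → ℕ) (f : B → FreeMonoid α), (∀ b, (f b).length = N (e b)) →
      ∀ x, crossed (fun _ => 1) (toRatVec N ∘ e) (θ (FreeMonoid.of x)).toList =
        ((FreeMonoid.lift f (θ (FreeMonoid.of x))).length : ℚ) := by
    intro N f hf x
    rw [crossed_one, FreeMonoid.length_lift, Nat.cast_list_sum, List.map_map]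
    congr 2
    funext b
    simp [toRatVec, hf]
  refine ⟨(crossedLin (fun _ => 1) θ).comp (LinearMap.funLeft ℚ ℚ e), ?_, ?_, fun N hN => ?_⟩
  · rw [LinearMap.coe_comp]
    refine Function.Injective.comp ?_ (LinearMap.funLeft_injective_of_surjective ℚ ℚ e e.surjective)
    rw [injective_iff_map_eq_zero]
    exact fun p hp => hinj' p fun x => congrFun hp x
  · refine ⟨toRatVec fun j => (e.symm j).1.length, funext fun x => ?_⟩
    have := hT (fun j => (e.symm j).1.length) Subtype.val (fun b => by simp) x
    rw [hθ] at this
    exact this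
  · refine ⟨(FreeMonoid.lift fun b => FreeMonoid.of (c (e b)) ^ N (e b)).comp θ,
      ⟨⟨?_, ?_⟩, ?_, ?_⟩, funext fun x => hT N _ (fun b => length_of_pow _ _) x⟩
    -- As `B` is a code, `θ` itself solves the equation, so every substitution into `θ` does.
    · rw [MonoidHom.comp_apply, MonoidHom.comp_apply,
        hB ((hθ _).trans (hE₁.1.trans (hθ _).symm))]
    · exact (morphismRank_lift_pow hinj' (hc.comp e.injective) fun b => hN (e b)).trans hcard
    · rw [MonoidHom.comp_apply, MonoidHom.comp_apply,
        hB ((hθ _).trans (hE₂.1.trans (hθ _).symm))]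
    · exact (morphismRank_lift_pow hinj' (hc.comp e.injective) fun b => hN (e b)).trans hcard

/-- Two polynomials that have the same specialisation at the image of every positive integral vector
have the same specialisation at every point of the range. -/
theorem specialize_eq_of_mem_range {m : ℕ} {T : (Fin m → ℚ) →ₗ[ℚ] (Fin n → ℚ)}
    {P Q : MvPolynomial (Fin n) ℕ}
    (hT : ∀ N : Fin m → ℕ, (∀ j, 0 < N j) → ∃ M : Fin n → ℕ,
      T (toRatVec N) = toRatVec M ∧ specialize M P = specialize M Q)
    {L : Fin n → ℕ} (hL : toRatVec L ∈ LinearMap.range T) :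
    specialize L P = specialize L Q := by
  classical
  set F := P.support ∪ Q.support
  -- For generic `N`, exponents in `F` that pair equally with the image of `N` do so on the whole
  -- range of `T`.
  obtain ⟨N, hN, hgen⟩ := exists_pos_notMem
    (fun i : {i : F × F // LinearMap.ker ((expDiff i.1.1 i.2.1).comp T) ≠ ⊤} =>
      LinearMap.ker ((expDiff i.1.1.1 i.1.2.1).comp T)) fun i => i.2
  obtain ⟨M, hM, hPQ⟩ := hT N hN
  obtain ⟨v, hv⟩ := hL
  have hsep : ∀ e ∈ F, ∀ e' ∈ F, expPairing M e = expPairing M e' →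
      expPairing L e = expPairing L e' := by
    intro e he e' he' h
    have htop : LinearMap.ker ((expDiff e e').comp T) = ⊤ := by
      by_contra hne
      refine hgen ⟨(⟨e, he⟩, ⟨e', he'⟩), hne⟩ ?_
      rw [LinearMap.mem_ker, LinearMap.comp_apply, hM]
      exact expDiff_toRatVec_eq_zero.2 h
    have : v ∈ LinearMap.ker ((expDiff e e').comp T) := htop ▸ Submodule.mem_top
    rw [LinearMap.mem_ker, LinearMap.comp_apply, hv] at this
    exact expDiff_toRatVec_eq_zero.1 this
  obtain ⟨g, hg⟩ : ∃ g : ℕ → ℕ, ∀ e ∈ F, g (expPairing M e) = expPairing L e := by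
    refine ⟨fun k => if hk : ∃ e ∈ F, expPairing M e = k then expPairing L hk.choose else 0,
      fun e he => ?_⟩
    have hk : ∃ e' ∈ F, expPairing M e' = expPairing M e := ⟨e, he, rfl⟩
    refine (dif_pos hk).trans ?_
    exact hsep _ hk.choose_spec.1 _ he hk.choose_spec.2
  -- The additive map `X ^ k ↦ X ^ g k` turns specialisation at `M` into specialisation at `L`.
  have key : ∀ R : MvPolynomial (Fin n) ℕ, R.support ⊆ F → specialize L R =
      Polynomial.lsum (fun k => Polynomial.monomial (R := ℕ) (g k)) (specialize M R) := by
    intro R hR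
    rw [specialize_eq_sum L R hR, specialize_eq_sum M R hR, map_sum]
    refine Finset.sum_congr rfl fun e he => ?_
    rw [Polynomial.lsum_apply, Polynomial.sum_monomial_index _ _ (by simp), hg e he]
  rw [key P Finset.subset_union_left, key Q Finset.subset_union_right, hPQ]

/-- In a minimal cover of the length types by hyperplanes, each hyperplane consists of length types
at which both equations have the same solutions of rank `n - 1`. -/
theorem solRankLength_eq_of_minimal_cover {E₁ E₂ : WordEquation n} (h₁ : E₁.Nontrivial)
    (h₂ : E₂.Nontrivial) {ι : Type*} [Finite ι] {V : ι → Submodule ℚ (Fin n → ℚ)}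
    (hV : IsMinimalSubspaceCover (n - 1) (pairLengthTypes α (n - 1) E₁ E₂) V) {i : ι}
    {L : Fin n → ℕ} (hL : toRatVec L ∈ V i) :
    solRankLength α (n - 1) L E₁ = solRankLength α (n - 1) L E₂ := by
  obtain ⟨⟨hdim, hcov⟩, hminimal⟩ := hV
  -- Minimality gives a common solution whose length type lies in `V i` and in no `V j` with another
  -- index.
  obtain ⟨h, ⟨hE₁, hE₂⟩, hpriv⟩ : ∃ h ∈ solRank α (n - 1) E₁ ∩ solRank α (n - 1) E₂,
      ∀ j, toRatVec (lengthType h) ∈ V j → j = i := by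
    by_contra! hcon
    have := hminimal {i}ᶜ (by
      rintro _ ⟨h, hh, rfl⟩
      obtain ⟨j, hj, hji⟩ := hcon h hh
      exact Set.mem_iUnion₂.2 ⟨j, hji, hj⟩)
    exact absurd (this ▸ Set.mem_univ i : i ∈ ({i}ᶜ : Set ι)) (by simp)
  obtain ⟨T, hTinj, hLT, hT⟩ := exists_parametrization h₁ hE₁ hE₂
  have hle : LinearMap.range T ≤ V i := by
    by_contra hnot
    have hall : ∀ j, ¬ LinearMap.range T ≤ V j := fun j hj => by
      rw [hpriv j (hj hLT)] at hj
      exact hnot hj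
    -- If the range of `T` lay in no `V j`, a generic positive `N` would give a common solution
    -- outside the cover.
    obtain ⟨N, hN, hgen⟩ := exists_pos_notMem (fun j => (V j).comap T) fun j htop =>
      hall j (by
        rw [LinearMap.range_eq_map, Submodule.map_le_iff_le_comap, htop])
    obtain ⟨h', hh', heq⟩ := hT N hN
    obtain ⟨j, hj⟩ := Set.mem_iUnion.1 (hcov ⟨h', hh', rfl⟩)
    refine hgen j ?_
    rw [Submodule.mem_comap, heq]
    exact hj
  have heq : LinearMap.range T = V i := Submodule.eq_of_le_of_finrank_eq hle (by
    rw [LinearMap.finrank_range_of_inj hTinj, hdim, Module.finrank_fin_fun])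
  refine solRankLength_eq_of_minors h₁ h₂ fun k l _ => ?_
  rw [← specialize_minorPos, ← specialize_minorNeg]
  refine specialize_eq_of_mem_range (T := T) (fun N hN => ?_) (heq ▸ hL)
  obtain ⟨h', hh', hM⟩ := hT N hN
  refine ⟨lengthType h', hM, ?_⟩
  rw [specialize_minorPos, specialize_minorNeg, minors_eq_of_mem hh'.1 hh'.2]

end Parametrization

theorem mainTheorem3 {α : Type*} {n : ℕ} (E₁ E₂ : WordEquation n)
    (h₁ : E₁.Nontrivial) (h₂ : E₂.Nontrivial)
    (hne : solRank α (n - 1) E₁ ≠ solRank α (n - 1) E₂) :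
    (∃ k l : Fin n, k ≠ l ∧
      ∃ V : Fin ((E₁.occ k + E₁.occ l) ^ 2) → Submodule ℚ (Fin n → ℚ),
        IsSubspaceCover (n - 1) (pairLengthTypes α (n - 1) E₁ E₂) V) ∧
    (∀ (m : ℕ) (V : Fin m → Submodule ℚ (Fin n → ℚ)),
      IsMinimalSubspaceCover (n - 1) (pairLengthTypes α (n - 1) E₁ E₂) V →
      ∀ (i : Fin m) (L : Fin n → ℕ), toRatVec L ∈ V i →
        solRankLength α (n - 1) L E₁ = solRankLength α (n - 1) L E₂) :=
  ⟨exists_subspaceCover h₁ h₂ hne,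
    fun _ _ hV _ _ hL => solRankLength_eq_of_minimal_cover h₁ h₂ hV hL⟩
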